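/- All groups are finite. For a subgroup $H$ of a group $G$, the Frobenius graph $\Gamma(G,H)$ is the bipartite graph on the disjoint union of $\mathrm{Irr}(G)$ and $\mathrm{Irr}(H)$ (complex irreducible characters) in which $\chi\in\mathrm{Irr}(G)$ and $\varphi\in\mathrm{Irr}(H)$ are joined whenever $[\chi_H,\varphi]\neq 0$. A subgroup $H$ of $G$ is a diameter three subgroup if $\Gamma(G,H)$ has diameter $3$. A group is minimal with a diameter three subgroup if it has a diameter three subgroup but none of its proper subgroups has one. Two groups $G_1,G_2$ are isoclinic if there are isomorphisms $G_1/Z(G_1)\cong G_2/Z(G_2)$ and $G_1'\cong G_2'$ that are compatible with the commutator maps. Proposition. Let $l\neq p$ be primes, let $q$ be a power of $l$, and let $G=E{:}C$ be a semidirect product of an elementary abelian $p$-group $E$ (normal) and a cyclic group $C$ of order $q$ that acts irreducibly on $E$. Assume that $G$ is minimal with a diameter three subgroup. Let $i\geq 0$, let $C_i$ be a cyclic group of order $q\cdot l^i$, and let $G_i$ be a subgroup of index $q$ in $G\times C_i$ whose Sylow $l$-subgroups are cyclic and act irreducibly on $E=E\times 1$. Then: (a) If $G_i\,(1\times C_i)=G\times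 C_i$, then $G_i$ is isoclinic to $G$. (b) If $G_i$ is isoclinic to $G$, then $G_i$ is minimal with a diameter three subgroup. -/

import Mathlib

open scoped ComplexConjugate commutatorElement

namespace FrobeniusGraphs

/-- `Irr(G)`: the set of complex irreducible characters of `G`, i.e. the characters of the
finite-dimensional irreducible complex representations of `G`. -/
def Irr (G : Type*) [Group G] : Set (G → ℂ) :=
  {χ | ∃ (V : Type) (_ : AddCommGroup V) (_ : Module ℂ V) (_ : FiniteDimensional ℂ V)
    (ρ : Representation ℂ G V), ρ.IsIrreducible ∧ ρ.character = χ}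

/-- The inner product `[α, β] = |H|⁻¹ ∑ h, α h * conj (β h)` of complex-valued functions on a
finite group `H`. -/
noncomputable def charInner {H : Type*} [Group H] [Finite H] (α β : H → ℂ) : ℂ :=
  (Nat.card H : ℂ)⁻¹ * ∑ᶠ h : H, α h * conj (β h)

/-- The restriction `χ_H` of a function on `G` to a subgroup `H`. -/
def restrict {G : Type*} [Group G] (χ : G → ℂ) (H : Subgroup G) : H → ℂ :=
  fun h => χ h

/-- The Frobenius graph `Γ(G, H)`: the bipartite graph on the disjoint union of `Irr(G)` and
`Irr(H)` in which `χ ∈ Irr(G)` and `φ ∈ Irr(H)` are adjacent when `[χ_H, φ] ≠ 0`. -/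
def frobeniusGraph {G : Type*} [Group G] [Finite G] (H : Subgroup G) :
    SimpleGraph (Irr G ⊕ Irr H) where
  Adj
    | .inl χ, .inr φ => charInner (restrict χ.1 H) φ.1 ≠ 0
    | .inr φ, .inl χ => charInner (restrict χ.1 H) φ.1 ≠ 0
    | .inl _, .inl _ => False
    | .inr _, .inr _ => False
  symm := ⟨by rintro (_ | _) (_ | _) h <;> exact h⟩
  loopless := ⟨by rintro (_ | _) h <;> exact h⟩

/-- `H` is a diameter three subgroup of `G`: the Frobenius graph `Γ(G, H)` has (finite)
diameter exactly `3`. -/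
def IsDiameterThreeSubgroup {G : Type*} [Group G] [Finite G] (H : Subgroup G) : Prop :=
  (frobeniusGraph H).ediam = 3

/-- `G` has a diameter three subgroup. -/
def HasDiameterThreeSubgroup (G : Type*) [Group G] [Finite G] : Prop :=
  ∃ H : Subgroup G, IsDiameterThreeSubgroup H

/-- `G` is minimal (with respect to inclusion of subgroups) with the property that it has a
diameter three subgroup. -/
def IsMinimalDiameterThree (G : Type*) [Group G] [Finite G] : Prop :=
  HasDiameterThreeSubgroup G ∧ ∀ U : Subgroup G, U ≠ ⊤ → ¬ HasDiameterThreeSubgroup U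

/-- `N` is an elementary abelian `p`-subgroup. -/
def IsElementaryAbelian {G : Type*} [Group G] (p : ℕ) (N : Subgroup G) : Prop :=
  (∀ x ∈ N, ∀ y ∈ N, x * y = y * x) ∧ ∀ x ∈ N, x ^ p = 1

/-- The subgroup `S` normalizes the subgroup `N` and acts irreducibly on it by conjugation:
`N` is nontrivial and its only `S`-invariant subgroups are the trivial one and `N`.  (If `N` is
elementary abelian of exponent `p`, its subgroups are its subspaces over the field with `p`
elements.) -/
def ActsIrreduciblyOn {G : Type*} [Group G] (S N : Subgroup G) : Prop :=
  (∀ s ∈ S, ∀ n ∈ N, s * n * s⁻¹ ∈ N) ∧ N ≠ ⊥ ∧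
    ∀ K : Subgroup G, K ≤ N → (∀ s ∈ S, ∀ k ∈ K, s * k * s⁻¹ ∈ K) → K = ⊥ ∨ K = N

/-- The groups `G` and `H` are isoclinic: there are isomorphisms `G / Z(G) ≃ H / Z(H)` and
`G' ≃ H'` that are compatible with the commutator maps. -/
def IsIsoclinic (G H : Type*) [Group G] [Group H] : Prop :=
  ∃ (φ : (G ⧸ Subgroup.center G) ≃* (H ⧸ Subgroup.center H))
    (ψ : commutator G ≃* commutator H),
    ∀ (x y : G) (x' y' : H),
      φ (x : G ⧸ Subgroup.center G) = (x' : H ⧸ Subgroup.center H) →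
      φ (y : G ⧸ Subgroup.center G) = (y' : H ⧸ Subgroup.center H) →
      (ψ ⟨⁅x, y⁆, Subgroup.commutator_mem_commutator (Subgroup.mem_top x)
        (Subgroup.mem_top y)⟩ : H) = ⁅x', y'⁆

end FrobeniusGraphs

/-! A diameter three subgroup lies in the derived subgroup, so only restrictions of irreducible
characters to the derived subgroup matter. Let `f : K →* G` be onto with kernel meeting `commutator
K` trivially. The kernel is then central and its characters extend to `K`, so each irreducible
character of `K` is an inflated one times a linear character. Hence diameter three subgroups of `K`
and `G` correspond (`isDiameterThreeSubgroup_map_iff`).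

Isoclinic groups are both such images of their fibre product over the common central quotient
(`IsIsoclinic.transfer`). Thus the property passes from `G` to `Gi`, and a proper subgroup `U` of
`Gi` having it must satisfy `U Z(Gi) = Gi`, as otherwise `G` would not be minimal. No such `U`
exists (`eq_top_of_sup_center_eq_top`): irreducibility forces the derived subgroup of `Gi` to be `E
× 1`, with the cyclic `l`-group `P` as complement, and the subgroups of `P` form a chain.

Part (a) is the projection of `Gi` to `G`, which is onto with central kernel meeting the derived
subgroup trivially. -/

namespace FrobeniusGraphs

/-! ### Irreducible representations and linear constituents. -/

/-- A representation is irreducible iff its space is nonzero and has no invariant submodules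
besides the trivial ones. -/
theorem isIrreducible_iff {G k V : Type*} [Monoid G] [Field k] [AddCommGroup V] [Module k V]
    (ρ : Representation k G V) :
    ρ.IsIrreducible ↔ Nontrivial V ∧ ∀ W : Submodule k V,
      (∀ g, ∀ v ∈ W, ρ g v ∈ W) → W = ⊥ ∨ W = ⊤ := by
  have hbot : (⊥ : Subrepresentation ρ).toSubmodule = ⊥ := rfl
  have htop : (⊤ : Subrepresentation ρ).toSubmodule = ⊤ := rfl
  constructor
  · intro h
    refine ⟨?_, fun W hW => ?_⟩
    · by_contra hV
      rw [not_nontrivial_iff_subsingleton] at hV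
      obtain ⟨x, y, hxy⟩ := h.toNontrivial
      exact hxy (Subrepresentation.toSubmodule_injective (Subsingleton.elim _ _))
    · rcases h.eq_bot_or_eq_top ⟨W, fun g v hv => hW g v hv⟩ with h | h
      · left
        rw [← hbot, ← h]
      · right
        rw [← htop, ← h]
  · rintro ⟨hV, h⟩
    have : Nontrivial (Subrepresentation ρ) := by
      refine ⟨⊥, ⊤, fun e => ?_⟩
      have := congrArg Subrepresentation.toSubmodule e
      rw [hbot, htop] at this
      exact bot_ne_top this
    refine ⟨fun W => ?_⟩
    rcases h W.toSubmodule (fun g v hv => W.apply_mem_toSubmodule g hv) with h | h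
    · exact Or.inl (Subrepresentation.toSubmodule_injective (h.trans hbot.symm))
    · exact Or.inr (Subrepresentation.toSubmodule_injective (h.trans htop.symm))

/-- An endomorphism commuting with an irreducible complex representation is a scalar. -/
theorem exists_scalar_of_commute {G V : Type*} [Monoid G] [AddCommGroup V] [Module ℂ V]
    [FiniteDimensional ℂ V] {ρ : Representation ℂ G V} (hρ : ρ.IsIrreducible)
    (T : V →ₗ[ℂ] V) (hT : ∀ g v, T (ρ g v) = ρ g (T v)) : ∃ c : ℂ, ∀ v, T v = c • v := by
  obtain ⟨hV, hW⟩ := (isIrreducible_iff ρ).1 hρ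
  obtain ⟨c, hc⟩ := Module.End.exists_eigenvalue T
  refine ⟨c, fun v => ?_⟩
  have := (hW (Module.End.eigenspace T c) (fun g v hv => ?_)).resolve_left hc
  · exact Module.End.mem_eigenspace_iff.1 (this ▸ Submodule.mem_top)
  · rw [Module.End.mem_eigenspace_iff] at hv ⊢
    rw [hT, hv, map_smul]

/-- Inflation of irreducible characters along a surjective homomorphism. -/
theorem comp_mem_irr {G K : Type*} [Group G] [Group K] (f : K →* G)
    (hf : Function.Surjective f) {χ : G → ℂ} (hχ : χ ∈ Irr G) : χ ∘ f ∈ Irr K := by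
  obtain ⟨V, _, _, _, ρ, hρ, rfl⟩ := hχ
  refine ⟨V, inferInstance, inferInstance, inferInstance, ρ.comp f, ?_, rfl⟩
  rw [isIrreducible_iff] at hρ ⊢
  refine ⟨hρ.1, fun W hW => hρ.2 W fun g v hv => ?_⟩
  obtain ⟨k, rfl⟩ := hf g
  exact hW k v hv

/-- The representation of degree one afforded by a linear character. -/
noncomputable def linearRep {G : Type*} [Group G] (α : G →* ℂˣ) : Representation ℂ G ℂ where
  toFun g := (α g : ℂ) • LinearMap.id
  map_one' := by ext; simp
  map_mul' x y := by ext; simp [mul_comm]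

theorem linear_mem_irr {G : Type*} [Group G] (α : G →* ℂˣ) : (fun g => (α g : ℂ)) ∈ Irr G := by
  refine ⟨ℂ, inferInstance, inferInstance, inferInstance, linearRep α, ?_, ?_⟩
  · rw [isIrreducible_iff]
    refine ⟨inferInstance, fun W _ => ?_⟩
    exact eq_bot_or_eq_top (W : Ideal ℂ)
  · ext g
    simp [Representation.character, linearRep]

theorem conj_monoidHom_units {G : Type*} [Group G] [Finite G] (α : G →* ℂˣ) (g : G) :
    conj (α g : ℂ) = (α g⁻¹ : ℂ) := by
  have h : ‖(α g : ℂ)‖ = 1 := by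
    refine Complex.norm_eq_one_of_pow_eq_one (n := Nat.card G) ?_ Nat.card_pos.ne'
    rw [← Units.val_pow_eq_pow_val, ← map_pow, pow_card_eq_one', map_one, Units.val_one]
  rw [map_inv, Units.val_inv_eq_inv_val, Complex.inv_eq_conj h]

/-- If a linear character is a constituent of an irreducible character, then the latter is
afforded by scalars given by the former. -/
theorem eq_of_charInner_ne_zero {H : Type*} [Group H] [Finite H] (α β : H →* ℂˣ) {φ : H → ℂ}
    (hφ : φ ∈ Irr H) (hα : charInner (fun h => (α h : ℂ)) φ ≠ 0)
    (hβ : charInner (fun h => (β h : ℂ)) φ ≠ 0) : α = β := by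
  obtain ⟨V, _, _, _, ρ, hρ, rfl⟩ := hφ
  have key : ∀ γ : H →* ℂˣ, charInner (fun h => (γ h : ℂ)) ρ.character ≠ 0 →
      ∀ g v, ρ g v = (γ g : ℂ) • v := by
    intro γ hγ
    have := Fintype.ofFinite H
    obtain ⟨hV, hW⟩ := (isIrreducible_iff ρ).1 hρ
    -- Unnormalized projection onto the `γ`-isotypic part; its trace is, up to conjugation and the
    -- factor `|H|`, the inner product.
    let T : V →ₗ[ℂ] V := ∑ h : H, (γ h⁻¹ : ℂ) • ρ h
    have hT : T ≠ 0 := by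
      intro h0
      apply hγ
      have h1 : conj (LinearMap.trace ℂ V T) = 0 := by rw [h0]; simp
      rw [charInner, finsum_eq_sum_of_fintype]
      convert mul_zero _
      rw [← h1]
      simp only [T, map_sum, map_smul, smul_eq_mul, map_mul, conj_monoidHom_units, inv_inv,
        Representation.character]
    have hgT : ∀ g v, ρ g (T v) = (γ g : ℂ) • T v := by
      intro g v
      simp only [T, LinearMap.sum_apply, map_sum, Finset.smul_sum, LinearMap.smul_apply, map_smul]
      refine Fintype.sum_equiv (Equiv.mulLeft g) _ _ fun h => ?_
      simp only [Equiv.coe_mulLeft, mul_inv_rev, map_mul, Units.val_mul, smul_smul,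
        Module.End.mul_apply]
      congr 1
      rw [mul_comm, mul_assoc, ← Units.val_mul, ← map_mul]
      simp
    have hr := (hW (LinearMap.range T) ?_).resolve_left (by rwa [LinearMap.range_eq_bot])
    · intro g v
      obtain ⟨w, rfl⟩ : v ∈ LinearMap.range T := hr ▸ Submodule.mem_top
      exact hgT g w
    · rintro g _ ⟨w, rfl⟩
      rw [hgT]
      exact Submodule.smul_mem _ _ ⟨w, rfl⟩
  obtain ⟨hV, -⟩ := (isIrreducible_iff ρ).1 hρ
  obtain ⟨v, hv⟩ := exists_ne (0 : V)
  ext g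
  have := (key α hα g v).symm.trans (key β hβ g v)
  exact smul_left_injective ℂ hv this

/-! ### Twisting irreducible characters so that they descend to a quotient. -/

/-- A linear character of a subgroup meeting the derived subgroup trivially extends. -/
theorem exists_linear_extension {K : Type*} [Group K] [Finite K] (N : Subgroup K)
    (hN : ∀ x ∈ commutator K, x ∈ N → x = 1) (l : N →* ℂˣ) :
    ∃ ν : K →* ℂˣ, ∀ n : N, ν n = l n := by
  let j : N →* Abelianization K := (Abelianization.of).comp N.subtype
  have hj : Function.Injective j := by
    rw [injective_iff_map_eq_one]
    intro n hn
    have : (n : K) ∈ commutator K := by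
      rw [← Abelianization.ker_of K]
      exact hn
    exact Subtype.ext (hN n this n.2)
  let e := MonoidHom.ofInjective hj
  have : Finite (Abelianization K) := Quotient.finite _
  have : NeZero (Monoid.exponent (Abelianization K)) :=
    ⟨Monoid.exponent_ne_zero_of_finite⟩
  obtain ⟨μ, hμ⟩ := MonoidHom.domRestrict_surjective ℂ j.range (l.comp e.symm.toMonoidHom)
  refine ⟨μ.comp Abelianization.of, fun n => ?_⟩
  have h := DFunLike.congr_fun hμ (e n)
  have h2 : (l.comp e.symm.toMonoidHom) (e n) = l n := congrArg l (e.symm_apply_apply n)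
  rw [h2] at h
  exact h

/-- The twist of a representation by a linear character. -/
noncomputable def twist {K V : Type*} [Group K] [AddCommGroup V] [Module ℂ V] (ν : K →* ℂˣ)
    (ρ : Representation ℂ K V) : Representation ℂ K V where
  toFun g := (ν g : ℂ) • ρ g
  map_one' := by simp
  map_mul' x y := by
    ext v
    simp only [map_mul, Units.val_mul, LinearMap.smul_apply, Module.End.mul_apply, map_smul,
      smul_smul, mul_comm]

/-- A homomorphism to a monoid that is trivial on the kernel of a surjective homomorphism
factors through the latter. -/
theorem exists_lift_of_ker_eq_one {G K M : Type*} [Group G] [Group K] [Monoid M] (f : K →* G)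
    (hf : Function.Surjective f) (σ : K →* M) (hσ : ∀ n ∈ f.ker, σ n = 1) :
    ∃ τ : G →* M, ∀ k, τ (f k) = σ k := by
  have key : ∀ x y, f x = f y → σ x = σ y := by
    intro x y h
    have hn : x * y⁻¹ ∈ f.ker := by
      rw [MonoidHom.mem_ker, map_mul, map_inv, h, mul_inv_cancel]
    rw [← one_mul (σ y), ← hσ _ hn, ← map_mul, inv_mul_cancel_right]
  have hs := Function.surjInv_eq hf
  refine ⟨{ toFun := fun g => σ (Function.surjInv hf g), map_one' := ?_, map_mul' := ?_ }, ?_⟩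
  · rw [key _ 1 (by rw [hs, map_one]), map_one]
  · intro x y
    rw [← map_mul]
    exact key _ _ (by rw [map_mul, hs, hs, hs])
  · exact fun k => key _ _ (hs _)

/-- If the kernel of a surjective homomorphism meets the derived subgroup trivially, then every
irreducible character agrees on the derived subgroup with one that is inflated along the
homomorphism. -/
theorem exists_irr_comp_eq_on_commutator {G K : Type*} [Group G] [Group K] [Finite K]
    (f : K →* G) (hf : Function.Surjective f)
    (hker : ∀ x ∈ commutator K, f x = 1 → x = 1) {χ : K → ℂ} (hχ : χ ∈ Irr K) :
    ∃ χ' ∈ Irr G, ∀ x ∈ commutator K, χ' (f x) = χ x := by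
  obtain ⟨V, _, _, _, ρ, hρ, rfl⟩ := hχ
  have hcent : ∀ n ∈ f.ker, ∀ k, n * k = k * n := by
    intro n hn k
    have h := hker ⁅n, k⁆ (Subgroup.commutator_mem_commutator (Subgroup.mem_top n)
      (Subgroup.mem_top k)) (by rw [map_commutatorElement, MonoidHom.mem_ker.1 hn]; simp)
    exact commutatorElement_eq_one_iff_mul_comm.1 h
  obtain ⟨hV, hW⟩ := (isIrreducible_iff ρ).1 hρ
  have hsc : ∀ n : f.ker, ∃ c : ℂ, ∀ v, ρ n v = c • v := by
    intro n
    refine exists_scalar_of_commute hρ (ρ n) fun g v => ?_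
    rw [← Module.End.mul_apply, ← Module.End.mul_apply, ← map_mul, ← map_mul, hcent n n.2]
  choose c hc using hsc
  obtain ⟨v₀, hv₀⟩ := exists_ne (0 : V)
  have hinj : ∀ a b : ℂ, a • v₀ = b • v₀ → a = b := fun a b h => smul_left_injective ℂ hv₀ h
  let l : f.ker →* ℂ :=
    { toFun := c
      map_one' := hinj _ _ (by rw [← hc]; simp)
      map_mul' := fun x y => hinj _ _ (by
        rw [← hc, Subgroup.coe_mul, map_mul, Module.End.mul_apply, hc y, map_smul, hc x,
          smul_smul, mul_comm]) }
  -- Twisting `ρ` by the inverse of an extension `μ` of its central character `l` kills the kernel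
  -- and changes nothing on the derived subgroup.
  obtain ⟨μ, hμ⟩ := exists_linear_extension f.ker hker l.toHomUnits
  have hν : ∀ x ∈ commutator K, μ⁻¹ x = 1 := by
    intro x hx
    have h : x ∈ (μ⁻¹).ker := Abelianization.commutator_subset_ker _ hx
    exact h
  have hσker : ∀ n ∈ f.ker, twist μ⁻¹ ρ n = 1 := by
    intro n hn
    ext v
    change (μ⁻¹ n : ℂˣ).val • ρ n v = v
    have h1 : ρ n v = _ := hc ⟨n, hn⟩ v
    have h2 : (μ n : ℂ) = c ⟨n, hn⟩ := congrArg Units.val (hμ ⟨n, hn⟩)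
    rw [h1, ← h2, smul_smul, ← Units.val_mul, MonoidHom.inv_apply, inv_mul_cancel, Units.val_one,
      one_smul]
  obtain ⟨τ, hτ'⟩ : ∃ τ : Representation ℂ G V, ∀ k, τ (f k) = twist μ⁻¹ ρ k :=
    exists_lift_of_ker_eq_one f hf (twist μ⁻¹ ρ) hσker
  have hτ : ∀ k, τ (f k) = (μ⁻¹ k : ℂˣ).val • ρ k := hτ'
  refine ⟨τ.character, ⟨V, inferInstance, inferInstance, inferInstance, τ, ?_, rfl⟩, ?_⟩
  · rw [isIrreducible_iff]
    refine ⟨hV, fun W h => hW W fun k v hv => ?_⟩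
    have := W.smul_mem ((μ⁻¹ k : ℂˣ).val⁻¹) (h (f k) v hv)
    rw [hτ, LinearMap.smul_apply, smul_smul, inv_mul_cancel₀ (Units.ne_zero _), one_smul] at this
    exact this
  · intro x hx
    rw [Representation.character, hτ, hν x hx, Units.val_one, one_smul]
    rfl

/-! ### Diameter three in bipartite graphs. -/

/-- The combinatorial description of the bipartite graphs of diameter three. -/
theorem ediam_eq_three_iff {X Y : Type*} (Γ : SimpleGraph (X ⊕ Y))
    (hX : ∀ x x', ¬ Γ.Adj (.inl x) (.inl x')) (hY : ∀ y y', ¬ Γ.Adj (.inr y) (.inr y')) :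
    Γ.ediam = 3 ↔ (∃ x y, ¬ Γ.Adj (.inl x) (.inr y)) ∧
      (∀ x x', ∃ y, Γ.Adj (.inl x) (.inr y) ∧ Γ.Adj (.inl x') (.inr y)) ∧
      (∀ y y', ∃ x, Γ.Adj (.inl x) (.inr y) ∧ Γ.Adj (.inl x) (.inr y')) := by
  have hwalk : Γ.ediam ≤ 3 → ∀ u v, ∃ w : Γ.Walk u v, w.length ≤ 3 := by
    intro h u v
    have h1 : Γ.edist u v ≤ 3 := SimpleGraph.edist_le_ediam.trans h
    have h2 : Γ.Reachable u v := by
      rw [← SimpleGraph.edist_ne_top_iff_reachable]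
      exact ne_top_of_le_ne_top (by decide) h1
    obtain ⟨w, hw⟩ := h2.exists_walk_length_eq_edist
    exact ⟨w, by rw [← hw] at h1; exact_mod_cast h1⟩
  constructor
  · intro h3
    have hw := hwalk h3.le
    have hex : ∃ x y, ¬ Γ.Adj (.inl x) (.inr y) := by
      by_contra! hall
      have : Γ.ediam ≤ 2 := by
        -- With one side empty there are no edges, so connectedness leaves at most one vertex and
        -- the diameter is 0.
        have hne : Nonempty X ∧ Nonempty Y := by
          by_contra hcon
          have h0 : ∀ u v, ¬ Γ.Adj u v := by
            rintro (x | y) (x' | y') <;> first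
              | exact hX _ _
              | exact hY _ _
              | exact fun _ => hcon ⟨⟨‹X›⟩, ⟨‹Y›⟩⟩
          have h1 : ∀ u v : X ⊕ Y, u = v := by
            intro u v
            obtain ⟨w, -⟩ := hw u v
            cases w with
            | nil => rfl
            | cons h _ => exact absurd h (h0 _ _)
          have : Γ.ediam = 0 := by
            have : Subsingleton (X ⊕ Y) := ⟨h1⟩
            exact SimpleGraph.ediam_eq_zero_of_subsingleton
          rw [this] at h3
          exact absurd h3 (by decide)
        obtain ⟨⟨x₀⟩, ⟨y₀⟩⟩ := hne
        rw [SimpleGraph.ediam_le_iff]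
        rintro (x | y) (x' | y')
        · exact SimpleGraph.Walk.edist_le
            (.cons (hall x y₀) (.cons (hall x' y₀).symm .nil))
        · exact (SimpleGraph.Walk.edist_le (.cons (hall x y') .nil)).trans (by norm_num)
        · exact (SimpleGraph.Walk.edist_le (.cons (hall x' y).symm .nil)).trans (by norm_num)
        · exact SimpleGraph.Walk.edist_le
            (.cons (hall x₀ y).symm (.cons (hall x₀ y') .nil))
      rw [h3] at this
      exact absurd this (by decide)
    obtain ⟨x₀, y₀, -⟩ := id hex
    refine ⟨hex, fun x x' => ?_, fun y y' => ?_⟩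
    · obtain ⟨w, hl⟩ := hw (.inl x) (.inl x')
      match w, hl with
      -- Here `x = x'`, and any neighbour will do: the first step of a walk to `y₀` supplies one.
      | .nil, _ =>
        obtain ⟨w', -⟩ := hw (.inl x) (.inr y₀)
        match w' with
        | .cons (v := .inl _) h _ => exact absurd h (hX _ _)
        | .cons (v := .inr y) h _ => exact ⟨y, h, h⟩
      | .cons (v := .inl _) h _, _ => exact absurd h (hX _ _)
      | .cons (v := .inr y) h (.cons (v := .inr _) h' _), _ => exact absurd h' (hY _ _)
      | .cons (v := .inr y) h (.cons (v := .inl _) h' .nil), _ => exact ⟨y, h, h'.symm⟩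
      | .cons (v := .inr _) _ (.cons (v := .inl _) _ (.cons h .nil)), _ =>
        exact absurd h (hX _ _)
      | .cons _ (.cons _ (.cons _ (.cons _ _))), hl =>
        simp only [SimpleGraph.Walk.length_cons] at hl
        omega
    · obtain ⟨w, hl⟩ := hw (.inr y) (.inr y')
      match w, hl with
      | .nil, _ =>
        obtain ⟨w', -⟩ := hw (.inr y) (.inl x₀)
        match w' with
        | .cons (v := .inr _) h _ => exact absurd h (hY _ _)
        | .cons (v := .inl x) h _ => exact ⟨x, h.symm, h.symm⟩
      | .cons (v := .inr _) h _, _ => exact absurd h (hY _ _)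
      | .cons (v := .inl x) h (.cons (v := .inl _) h' _), _ => exact absurd h' (hX _ _)
      | .cons (v := .inl x) h (.cons (v := .inr _) h' .nil), _ => exact ⟨x, h.symm, h'⟩
      | .cons (v := .inl _) _ (.cons (v := .inr _) _ (.cons h .nil)), _ =>
        exact absurd h (hY _ _)
      | .cons _ (.cons _ (.cons _ (.cons _ _))), hl =>
        simp only [SimpleGraph.Walk.length_cons] at hl
        omega
  · rintro ⟨⟨x₀, y₀, h₀⟩, hx, hy⟩
    have hle : Γ.ediam ≤ 3 := by
      rw [SimpleGraph.ediam_le_iff]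
      have hxy : ∀ x y, Γ.edist (.inl x) (.inr y) ≤ 3 := by
        intro x y
        obtain ⟨y', h1, -⟩ := hx x x
        obtain ⟨x', h2, h3⟩ := hy y' y
        exact SimpleGraph.Walk.edist_le (.cons h1 (.cons h2.symm (.cons h3 .nil)))
      rintro (x | y) (x' | y')
      · obtain ⟨y, h1, h2⟩ := hx x x'
        exact (SimpleGraph.Walk.edist_le (.cons h1 (.cons h2.symm .nil))).trans (by norm_num)
      · exact hxy _ _
      · rw [SimpleGraph.edist_comm]
        exact hxy _ _
      · obtain ⟨x, h1, h2⟩ := hy y y'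
        exact (SimpleGraph.Walk.edist_le (.cons h1.symm (.cons h2 .nil))).trans (by norm_num)
    refine le_antisymm hle ?_
    refine le_trans ?_ (SimpleGraph.edist_le_ediam (u := .inl x₀) (v := .inr y₀))
    obtain ⟨w', -⟩ := hwalk hle (.inl x₀) (.inr y₀)
    obtain ⟨w, hw⟩ := w'.reachable.exists_walk_length_eq_edist
    rw [← hw]
    have : 3 ≤ w.length := by
      match w with
      | .cons h .nil => exact absurd h h₀
      | .cons (v := .inl _) h _ => exact absurd h (hX _ _)
      | .cons (v := .inr _) _ (.cons h' .nil) => exact absurd h' (hY _ _)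
      | .cons _ (.cons _ (.cons _ _)) => simp
    exact_mod_cast this

theorem isDiameterThreeSubgroup_iff {G : Type*} [Group G] [Finite G] (H : Subgroup G) :
    IsDiameterThreeSubgroup H ↔
      (∃ χ ∈ Irr G, ∃ φ ∈ Irr H, charInner (restrict χ H) φ = 0) ∧
      (∀ χ ∈ Irr G, ∀ χ' ∈ Irr G, ∃ φ ∈ Irr H,
        charInner (restrict χ H) φ ≠ 0 ∧ charInner (restrict χ' H) φ ≠ 0) ∧
      (∀ φ ∈ Irr H, ∀ φ' ∈ Irr H, ∃ χ ∈ Irr G,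
        charInner (restrict χ H) φ ≠ 0 ∧ charInner (restrict χ H) φ' ≠ 0) := by
  rw [IsDiameterThreeSubgroup, ediam_eq_three_iff _ (fun _ _ h => h) (fun _ _ h => h)]
  have hadj : ∀ (χ : Irr G) (φ : Irr H), (frobeniusGraph H).Adj (.inl χ) (.inr φ) ↔
    charInner (restrict χ.1 H) φ.1 ≠ 0 := fun _ _ => Iff.rfl
  simp only [hadj, Subtype.forall, Subtype.exists, not_not, exists_prop]

/-! ### Diameter three subgroups and surjections. -/

/-- A diameter three subgroup is contained in the derived subgroup. -/
theorem IsDiameterThreeSubgroup.le_commutator {G : Type*} [Group G] [Finite G] {H : Subgroup G}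
    (h : IsDiameterThreeSubgroup H) : H ≤ commutator G := by
  intro x hx
  rw [← Abelianization.ker_of G, MonoidHom.mem_ker]
  by_contra hne
  have : Finite (Abelianization G) := Quotient.finite _
  have : NeZero (Monoid.exponent (Abelianization G)) := ⟨Monoid.exponent_ne_zero_of_finite⟩
  obtain ⟨μ, hμ⟩ := CommGroup.exists_apply_ne_one_of_hasEnoughRootsOfUnity _ ℂ hne
  let α : G →* ℂˣ := μ.comp Abelianization.of
  obtain ⟨-, h2, -⟩ := (isDiameterThreeSubgroup_iff H).1 h
  -- `α` and the trivial character share a constituent on `H`, so they agree there, although `α` was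
  -- chosen nontrivial at `x`.
  obtain ⟨φ, hφ, ha, hb⟩ := h2 _ (linear_mem_irr α) _ (linear_mem_irr 1)
  have := eq_of_charInner_ne_zero (α.comp H.subtype) ((1 : G →* ℂˣ).comp H.subtype) hφ ha hb
  exact hμ (DFunLike.congr_fun this ⟨x, hx⟩)

theorem charInner_comp_mulEquiv {H H' : Type*} [Group H] [Finite H] [Group H'] [Finite H']
    (e : H ≃* H') (α β : H' → ℂ) : charInner (α ∘ e) (β ∘ e) = charInner α β := by
  rw [charInner, charInner, Nat.card_congr e.toEquiv]
  congr 1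
  exact finsum_comp_equiv e.toEquiv (f := fun h => α h * conj (β h))

/-- Diameter three subgroups correspond under surjective homomorphisms whose kernel meets the
derived subgroup trivially. -/
theorem isDiameterThreeSubgroup_map_iff {G K : Type*} [Group G] [Finite G] [Group K] [Finite K]
    (f : K →* G) (hf : Function.Surjective f) (hker : ∀ x ∈ commutator K, f x = 1 → x = 1)
    (H : Subgroup K) (hH : H ≤ commutator K) :
    IsDiameterThreeSubgroup (H.map f) ↔ IsDiameterThreeSubgroup H := by
  have hinj : Function.Injective (f.subgroupMap H) := by
    rw [injective_iff_map_eq_one]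
    intro x hx
    exact Subtype.ext (hker x (hH x.2) (congrArg Subtype.val hx))
  let e : H ≃* H.map f := MulEquiv.ofBijective (f.subgroupMap H) ⟨hinj, f.subgroupMap_surjective H⟩
  have hcomp : ∀ (χ : G → ℂ) (φ : H.map f → ℂ),
      charInner (restrict (χ ∘ f) H) (φ ∘ e) = charInner (restrict χ (H.map f)) φ :=
    fun χ φ => charInner_comp_mulEquiv e (restrict χ (H.map f)) φ
  -- Inflated characters already give every restriction to `H`, so quantifiers over `Irr K` can be
  -- moved to `Irr G`.
  have hG : ∀ P : (H → ℂ) → Prop, (∀ χ ∈ Irr K, P (restrict χ H)) ↔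
      ∀ χ ∈ Irr G, P (restrict (χ ∘ f) H) := by
    intro P
    refine ⟨fun h χ hχ => h _ (comp_mem_irr f hf hχ), fun h χ hχ => ?_⟩
    obtain ⟨χ', hχ', he⟩ := exists_irr_comp_eq_on_commutator f hf hker hχ
    have : restrict χ H = restrict (χ' ∘ f) H := funext fun x => (he x (hH x.2)).symm
    rw [this]
    exact h χ' hχ'
  have hG' : ∀ P : (H → ℂ) → Prop, (∃ χ ∈ Irr K, P (restrict χ H)) ↔
      ∃ χ ∈ Irr G, P (restrict (χ ∘ f) H) := by
    intro P
    have := not_congr (hG fun χ => ¬ P χ)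
    push Not at this
    exact this
  have hI : ∀ P : (H → ℂ) → Prop, (∀ φ ∈ Irr H, P φ) ↔ ∀ φ ∈ Irr (H.map f), P (φ ∘ e) := by
    intro P
    refine ⟨fun h φ hφ => h _ (comp_mem_irr e.toMonoidHom e.surjective hφ), fun h φ hφ => ?_⟩
    have := h _ (comp_mem_irr e.symm.toMonoidHom e.symm.surjective hφ)
    convert this
    ext x
    simp
  have hI' : ∀ P : (H → ℂ) → Prop, (∃ φ ∈ Irr H, P φ) ↔ ∃ φ ∈ Irr (H.map f), P (φ ∘ e) := by
    intro P
    have := not_congr (hI fun χ => ¬ P χ)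
    push Not at this
    exact this
  rw [isDiameterThreeSubgroup_iff, isDiameterThreeSubgroup_iff]
  refine and_congr ?_ (and_congr ?_ ?_)
  · rw [hG' fun χ => ∃ φ ∈ Irr H, charInner χ φ = 0]
    simp only [hI' fun φ => charInner _ φ = 0, hcomp]
  · rw [hG fun χ => ∀ χ' ∈ Irr K, ∃ φ ∈ Irr H, charInner χ φ ≠ 0 ∧ charInner (restrict χ' H) φ ≠ 0]
    refine forall₂_congr fun χ _ => ?_
    rw [hG fun χ' => ∃ φ ∈ Irr H, charInner (restrict (χ ∘ f) H) φ ≠ 0 ∧ charInner χ' φ ≠ 0]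
    simp only [hI' fun φ => charInner _ φ ≠ 0 ∧ charInner _ φ ≠ 0, hcomp]
  · rw [hI fun φ => ∀ φ' ∈ Irr H, ∃ χ ∈ Irr K,
      charInner (restrict χ H) φ ≠ 0 ∧ charInner (restrict χ H) φ' ≠ 0]
    refine forall₂_congr fun φ _ => ?_
    rw [hI fun φ' => ∃ χ ∈ Irr K,
      charInner (restrict χ H) (φ ∘ e) ≠ 0 ∧ charInner (restrict χ H) φ' ≠ 0]
    refine forall₂_congr fun φ' _ => ?_
    rw [hG' fun χ => charInner χ (φ ∘ e) ≠ 0 ∧ charInner χ (φ' ∘ e) ≠ 0]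
    simp only [hcomp]

theorem map_commutator_of_surjective {G K : Type*} [Group G] [Group K] (f : K →* G)
    (hf : Function.Surjective f) : (commutator K).map f = commutator G := by
  rw [map_commutator_eq, MonoidHom.range_eq_top.2 hf, commutator_def]

theorem hasDiameterThreeSubgroup_iff_of_surjective {G K : Type*} [Group G] [Finite G] [Group K]
    [Finite K] (f : K →* G) (hf : Function.Surjective f)
    (hker : ∀ x ∈ commutator K, f x = 1 → x = 1) :
    HasDiameterThreeSubgroup G ↔ HasDiameterThreeSubgroup K := by
  constructor
  · rintro ⟨H, hH⟩
    -- The full preimage may contain kernel elements; the part in `commutator K` still maps onto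
    -- `H`, since `H` lies in the derived subgroup of `G`.
    refine ⟨H.comap f ⊓ commutator K, ?_⟩
    rw [← isDiameterThreeSubgroup_map_iff f hf hker _ inf_le_right]
    convert hH
    refine le_antisymm ?_ ?_
    · rintro _ ⟨x, hx, rfl⟩
      exact hx.1
    · intro x hx
      have h1 := hH.le_commutator hx
      rw [← map_commutator_of_surjective f hf] at h1
      obtain ⟨y, hy, rfl⟩ := h1
      exact ⟨y, ⟨hx, hy⟩, rfl⟩
  · rintro ⟨H, hH⟩
    exact ⟨H.map f, (isDiameterThreeSubgroup_map_iff f hf hker H hH.le_commutator).2 hH⟩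

/-! ### Isoclinism. -/

/-- If an isoclinism carries `G₁` to `G₂`, then every subgroup `U` of `G₂` with `U Z(G₂) ≠ G₂`
having a diameter three subgroup yields a proper subgroup of `G₁` with a diameter three
subgroup; and `G₂` inherits the property from `G₁`. -/
theorem IsIsoclinic.transfer {G₁ G₂ : Type*} [Group G₁] [Finite G₁] [Group G₂] [Finite G₂]
    (h : IsIsoclinic G₁ G₂) :
    (HasDiameterThreeSubgroup G₁ → HasDiameterThreeSubgroup G₂) ∧
    ∀ U : Subgroup G₂, U ⊔ Subgroup.center G₂ ≠ ⊤ → HasDiameterThreeSubgroup U →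
      ∃ V : Subgroup G₁, V ≠ ⊤ ∧ HasDiameterThreeSubgroup V := by
  obtain ⟨φ, ψ, hcomp⟩ := h
  -- The fibre product of `G₁` and `G₂` over their identified central quotients.
  let K : Subgroup (G₁ × G₂) := MonoidHom.eqLocus
    ((φ.toMonoidHom.comp (QuotientGroup.mk' (Subgroup.center G₁))).comp (MonoidHom.fst G₁ G₂))
    ((QuotientGroup.mk' (Subgroup.center G₂)).comp (MonoidHom.snd G₁ G₂))
  have hK : ∀ x : G₁ × G₂, x ∈ K ↔
      φ (x.1 : G₁ ⧸ Subgroup.center G₁) = (x.2 : G₂ ⧸ Subgroup.center G₂) := fun _ => Iff.rfl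
  let f₁ : K →* G₁ := (MonoidHom.fst G₁ G₂).comp K.subtype
  let f₂ : K →* G₂ := (MonoidHom.snd G₁ G₂).comp K.subtype
  have hf₁ : Function.Surjective f₁ := by
    intro x
    obtain ⟨y, hy⟩ := QuotientGroup.mk_surjective (φ (x : G₁ ⧸ Subgroup.center G₁))
    exact ⟨⟨(x, y), (hK _).2 hy.symm⟩, rfl⟩
  have hf₂ : Function.Surjective f₂ := by
    intro y
    obtain ⟨x, hx⟩ := QuotientGroup.mk_surjective (φ.symm (y : G₂ ⧸ Subgroup.center G₂))
    exact ⟨⟨(x, y), (hK _).2 (by simp only [hx, MulEquiv.apply_symm_apply])⟩, rfl⟩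
  -- The derived subgroup of `K` lies in the graph of `ψ`, so both projections are injective on it.
  have hcomm : ∀ x ∈ commutator K, ∃ hx : f₁ x ∈ commutator G₁, (ψ ⟨f₁ x, hx⟩ : G₂) = f₂ x := by
    have hf1 : ∀ x ∈ commutator K, f₁ x ∈ commutator G₁ := fun x hx => by
      rw [← map_commutator_of_surjective f₁ hf₁]
      exact ⟨x, hx, rfl⟩
    intro x hx
    refine ⟨hf1 x hx, ?_⟩
    have hx' := hx
    rw [commutator_eq_closure] at hx'
    induction hx' using Subgroup.closure_induction with
    | mem x hxm =>
      obtain ⟨a, b, rfl⟩ := hxm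
      have := hcomp (f₁ a) (f₁ b) (f₂ a) (f₂ b) a.2 b.2
      simp only [map_commutatorElement]
      exact this
    | one =>
      have : (⟨f₁ 1, hf1 1 hx⟩ : commutator G₁) = 1 := Subtype.ext (map_one f₁)
      rw [this]
      simp
    | mul a b ha hb iha ihb =>
      rw [← commutator_eq_closure] at ha hb
      have : (⟨f₁ (a * b), hf1 _ hx⟩ : commutator G₁) = ⟨f₁ a, hf1 a ha⟩ * ⟨f₁ b, hf1 b hb⟩ :=
        Subtype.ext (map_mul f₁ a b)
      rw [this, map_mul, map_mul, Subgroup.coe_mul, iha ha, ihb hb]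
    | inv a ha iha =>
      rw [← commutator_eq_closure] at ha
      have : (⟨f₁ a⁻¹, hf1 _ hx⟩ : commutator G₁) = ⟨f₁ a, hf1 a ha⟩⁻¹ :=
        Subtype.ext (map_inv f₁ a)
      rw [this, map_inv, map_inv, Subgroup.coe_inv, iha ha]
  have hk₁ : ∀ x ∈ commutator K, f₁ x = 1 → x = 1 := by
    intro x hx h1
    obtain ⟨h2, h3⟩ := hcomm x hx
    have : (⟨f₁ x, h2⟩ : commutator G₁) = 1 := Subtype.ext h1
    rw [this, map_one] at h3
    exact Subtype.ext (Prod.ext h1 h3.symm)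
  have hk₂ : ∀ x ∈ commutator K, f₂ x = 1 → x = 1 := by
    intro x hx h1
    obtain ⟨h2, h3⟩ := hcomm x hx
    refine hk₁ x hx ?_
    rw [h1] at h3
    have : ψ ⟨f₁ x, h2⟩ = 1 := Subtype.ext h3
    exact congrArg Subtype.val ((map_eq_one_iff ψ ψ.injective).1 this)
  refine ⟨fun h => ?_, fun U hU h => ?_⟩
  · rw [hasDiameterThreeSubgroup_iff_of_surjective f₁ hf₁ hk₁] at h
    exact (hasDiameterThreeSubgroup_iff_of_surjective f₂ hf₂ hk₂).2 h
  · have hsub : ∀ x : U.comap f₂, x ∈ commutator (U.comap f₂) → (x : K) ∈ commutator K := by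
      intro x hx
      have : (x : K) ∈ (commutator (U.comap f₂)).map (U.comap f₂).subtype := ⟨x, hx, rfl⟩
      rw [Subgroup.map_subtype_commutator] at this
      exact Subgroup.commutator_mono le_top le_top this
    rw [hasDiameterThreeSubgroup_iff_of_surjective (f₂.subgroupComap U)
      (fun y => by
        obtain ⟨x, hx⟩ := hf₂ y
        exact ⟨⟨x, by rw [Subgroup.mem_comap, hx]; exact y.2⟩, Subtype.ext hx⟩)
      (fun x hx h1 => Subtype.ext (hk₂ x (hsub x hx) (congrArg Subtype.val h1)))] at h
    rw [← hasDiameterThreeSubgroup_iff_of_surjective (f₁.subgroupMap (U.comap f₂))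
      (f₁.subgroupMap_surjective _)
      (fun x hx h1 => Subtype.ext (hk₁ x (hsub x hx) (congrArg Subtype.val h1)))] at h
    -- If `f₁` maps the preimage of `U` onto `G₁`, every `x` in `K` agrees in its first coordinate
    -- with some `u` over `U`. The second coordinate of `u⁻¹ * x` is then central, whence `U Z(G₂) =
    -- G₂`.
    refine ⟨_, fun htop => hU ?_, h⟩
    rw [eq_top_iff]
    intro y _
    obtain ⟨x, rfl⟩ := hf₂ y
    obtain ⟨u, hu, hux⟩ : f₁ x ∈ (U.comap f₂).map f₁ := htop ▸ Subgroup.mem_top _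
    have hz : f₂ (u⁻¹ * x) ∈ Subgroup.center G₂ := by
      rw [← QuotientGroup.eq_one_iff]
      have h1 : f₁ (u⁻¹ * x) = 1 := by rw [map_mul, map_inv, hux, inv_mul_cancel]
      have h2 := (hK _).1 (u⁻¹ * x).2
      change φ (f₁ (u⁻¹ * x) : G₁) = _ at h2
      rw [h1, QuotientGroup.mk_one, map_one] at h2
      exact h2.symm
    have : f₂ x = f₂ u * f₂ (u⁻¹ * x) := by rw [← map_mul, mul_inv_cancel_left]
    rw [this]
    exact Subgroup.mul_mem_sup hu hz

/-- The projection of a subgroup `Q` of `G × A`, where `A` is abelian and `Q (1 × A) = G × A`,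
induces an isoclinism. -/
theorem isIsoclinic_of_sup_eq_top {G A : Type*} [Group G] [Group A] (hA : ∀ a b : A, a * b = b * a)
    (Q : Subgroup (G × A)) (hQ : Q ⊔ (⊥ : Subgroup G).prod (⊤ : Subgroup A) = ⊤) :
    IsIsoclinic G Q := by
  let π : Q →* G := (MonoidHom.fst G A).comp Q.subtype
  have hπ : Function.Surjective π := by
    intro g
    have h := congrArg (Subgroup.map (MonoidHom.fst G A)) hQ
    have h2 : ((⊥ : Subgroup G).prod (⊤ : Subgroup A)).map (MonoidHom.fst G A) = ⊥ := by
      rw [eq_bot_iff]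
      rintro _ ⟨x, hx, rfl⟩
      exact hx.1
    rw [Subgroup.map_sup, h2, sup_bot_eq] at h
    obtain ⟨x, hx, hxg⟩ : g ∈ Q.map (MonoidHom.fst G A) := by
      rw [h]
      exact ⟨(g, 1), Subgroup.mem_top _, rfl⟩
    exact ⟨⟨x, hx⟩, hxg⟩
  have hcen : ∀ x : Q, x ∈ Subgroup.center Q ↔ π x ∈ Subgroup.center G := by
    intro x
    simp only [Subgroup.mem_center_iff]
    constructor
    · intro h g
      obtain ⟨y, rfl⟩ := hπ g
      rw [← map_mul, ← map_mul, h]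
    · intro h y
      exact Subtype.ext (Prod.ext (h (π y)) (hA _ _))
  have hker : ((QuotientGroup.mk' (Subgroup.center G)).comp π).ker = Subgroup.center Q := by
    ext x
    rw [MonoidHom.mem_ker, hcen]
    exact QuotientGroup.eq_one_iff _
  let φ : (Q ⧸ Subgroup.center Q) ≃* (G ⧸ Subgroup.center G) :=
    (QuotientGroup.quotientMulEquivOfEq hker.symm).trans
      (QuotientGroup.quotientKerEquivOfSurjective _
        ((QuotientGroup.mk'_surjective _).comp hπ))
  have hφ : ∀ x : Q, φ (x : Q ⧸ Subgroup.center Q) = (π x : G ⧸ Subgroup.center G) := fun _ => rfl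
  have hsnd : ∀ x ∈ commutator Q, (x : G × A).2 = 1 := by
    have : commutator Q ≤ ((MonoidHom.snd G A).comp Q.subtype).ker := by
      rw [commutator_def, Subgroup.commutator_le]
      intro x _ y _
      rw [MonoidHom.mem_ker, map_commutatorElement, commutatorElement_eq_one_iff_mul_comm]
      exact hA _ _
    exact fun x hx => this hx
  have hπc : ∀ x : commutator Q, π x ∈ commutator G := fun x => by
    rw [← map_commutator_of_surjective π hπ]
    exact ⟨x, x.2, rfl⟩
  let ψ₀ : commutator Q →* commutator G :=
    (π.comp (commutator Q).subtype).codRestrict (commutator G) hπc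
  have hψ₀ : Function.Bijective ψ₀ := by
    constructor
    · intro x y hxy
      have h1 : (x : Q).1.1 = (y : Q).1.1 := congrArg Subtype.val hxy
      exact Subtype.ext (Subtype.ext (Prod.ext h1 ((hsnd x x.2).trans (hsnd y y.2).symm)))
    · rintro ⟨g, hg⟩
      rw [← map_commutator_of_surjective π hπ] at hg
      obtain ⟨x, hx, rfl⟩ := hg
      exact ⟨⟨x, hx⟩, rfl⟩
  let ψ := MulEquiv.ofBijective ψ₀ hψ₀
  refine ⟨φ.symm, ψ.symm, fun x y x' y' hx hy => ?_⟩
  rw [MulEquiv.symm_apply_eq, hφ] at hx hy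
  -- Commutators depend only on cosets of the center, which is all that `φ` controls.
  have key : ∀ x y x' y' : G, (x : G ⧸ Subgroup.center G) = x' →
      (y : G ⧸ Subgroup.center G) = y' → ⁅x, y⁆ = ⁅x', y'⁆ := by
    intro x y x' y' hx hy
    rw [QuotientGroup.eq] at hx hy
    obtain ⟨z, hz, rfl⟩ : ∃ z ∈ Subgroup.center G, x' = x * z := ⟨_, hx, by group⟩
    obtain ⟨w, hw, rfl⟩ : ∃ w ∈ Subgroup.center G, y' = y * w := ⟨_, hy, by group⟩
    rw [Subgroup.mem_center_iff] at hz hw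
    have h1 : ∀ a z : G, (∀ g, g * z = z * g) → ∀ g, ⁅a * z, g⁆ = ⁅a, g⁆ := fun a z hz g => by
      rw [commutatorElement_def, commutatorElement_def, mul_assoc a z g, ← hz g]
      group
    rw [h1 x z hz, ← commutatorElement_inv (y * w) x, h1 y w hw, commutatorElement_inv]
  have : ψ.symm ⟨⁅x, y⁆, Subgroup.commutator_mem_commutator (Subgroup.mem_top x)
      (Subgroup.mem_top y)⟩ = ⟨⁅x', y'⁆, Subgroup.commutator_mem_commutator (Subgroup.mem_top x')
      (Subgroup.mem_top y')⟩ := by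
    rw [MulEquiv.symm_apply_eq]
    refine Subtype.ext ?_
    change ⁅x, y⁆ = π ⁅x', y'⁆
    rw [map_commutatorElement]
    exact key _ _ _ _ hx hy
  rw [this]

/-- In an abelian group only the trivial subgroup is a candidate. There the inner product is a
product of values at 1, all nonzero by the common neighbour conditions, so no pair is nonadjacent.
-/
theorem HasDiameterThreeSubgroup.commutator_ne_bot {G : Type*} [Group G] [Finite G]
    (h : HasDiameterThreeSubgroup G) : commutator G ≠ ⊥ := by
  intro hb
  obtain ⟨H, hH⟩ := h
  obtain rfl : H = ⊥ := by
    rw [eq_bot_iff, ← hb]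
    exact hH.le_commutator
  have hin : ∀ α β : (⊥ : Subgroup G) → ℂ, charInner α β = α 1 * conj (β 1) := by
    intro α β
    rw [charInner, finsum_unique, Subgroup.card_bot, Nat.cast_one, inv_one, one_mul]
    rfl
  obtain ⟨⟨χ, hχ, φ, hφ, h0⟩, h2, h3⟩ := (isDiameterThreeSubgroup_iff _).1 hH
  obtain ⟨φ', -, h4, -⟩ := h2 χ hχ χ hχ
  obtain ⟨χ', -, h5, -⟩ := h3 φ hφ φ hφ
  rw [hin] at h0 h4 h5
  exact (mul_ne_zero (left_ne_zero_of_mul h4) (right_ne_zero_of_mul h5)) h0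

/-! ### Supplements of the center. -/

/-- The subgroups of a finite cyclic group of prime power order form a chain. -/
theorem _root_.IsCyclic.le_or_le_of_isPGroup {P : Type*} [Group P] [Finite P] [IsCyclic P] {l : ℕ}
    [Fact l.Prime] (hP : IsPGroup l P) (K L : Subgroup P) : K ≤ L ∨ L ≤ K := by
  classical
  have hpow : ∀ (M : Subgroup P) {x : P}, x ∈ M → x ^ Nat.card M = 1 := fun M x hx =>
    congrArg Subtype.val (pow_card_eq_one' (x := (⟨x, hx⟩ : M)))
  have key : ∀ K L : Subgroup P, Nat.card K ∣ Nat.card L → K ≤ L := by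
    intro K L hd x hx
    have := Fintype.ofFinite P
    -- A cyclic group has at most `m` solutions of `x ^ m = 1`; for `m = |L|` the elements of `L`
    -- exhaust them.
    let S : Finset P := {x | x ^ Nat.card L = 1}
    have h1 : S.card ≤ Nat.card L := IsCyclic.card_pow_eq_one_le Nat.card_pos
    have h2 : (L : Set P).toFinset ⊆ S := fun y hy => by
      have hy' : y ∈ L := by simpa using hy
      simpa [S] using hpow L hy'
    have hLc : ((L : Set P).toFinset).card = Nat.card L := by
      rw [Set.toFinset_card, ← Nat.card_eq_fintype_card]
      rfl
    have h3 := Finset.eq_of_subset_of_card_le h2 (h1.trans hLc.ge)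
    have hxS : x ∈ S := by
      obtain ⟨c, hc⟩ := hd
      simp only [S, Finset.mem_filter, Finset.mem_univ, true_and]
      rw [hc, pow_mul, hpow K hx, one_pow]
    rw [← h3] at hxS
    simpa using hxS
  obtain ⟨a, ha⟩ := IsPGroup.iff_card.1 (hP.to_subgroup K)
  obtain ⟨b, hb⟩ := IsPGroup.iff_card.1 (hP.to_subgroup L)
  rcases le_total a b with h | h
  · exact Or.inl (key K L (by rw [ha, hb]; exact pow_dvd_pow l h))
  · exact Or.inr (key L K (by rw [ha, hb]; exact pow_dvd_pow l h))

/-- A proper subgroup of a nonabelian group whose derived subgroup is abelian and complemented by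
a cyclic subgroup of prime power order does not supplement the center. -/
theorem eq_top_of_sup_center_eq_top {Q : Type*} [Group Q] [Finite Q] {l : ℕ} [Fact l.Prime]
    (hne : commutator Q ≠ ⊥) (hab : ∀ x ∈ commutator Q, ∀ y ∈ commutator Q, x * y = y * x)
    (P : Subgroup Q) (hPl : IsPGroup l P) (hPc : IsCyclic P) (hPN : P ⊔ commutator Q = ⊤)
    (U : Subgroup Q) (hU : U ⊔ Subgroup.center Q = ⊤) : U = ⊤ := by
  have hUn : U.Normal := by
    rw [← Subgroup.normalizer_eq_top_iff, eq_top_iff, ← hU]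
    exact sup_le Subgroup.le_normalizer (Subgroup.center_le_normalizer _)
  -- `Q / U` is an image of the center, hence abelian.
  have hNU : commutator Q ≤ U :=
    Subgroup.Normal.commutator_le_of_self_sup_commutative_eq_top hU inferInstance
  have hdec : ∀ x : Q, ∃ y ∈ P, ∃ n ∈ commutator Q, y * n = x := fun x =>
    Subgroup.mem_sup_of_normal_right.1 (show x ∈ P ⊔ commutator Q from hPN ▸ Subgroup.mem_top x)
  -- With `N` the derived subgroup, compare `U ∩ P` with `Z(Q)N ∩ P`. If the former is smaller, then
  -- `Q = Z(Q)N` is abelian, a contradiction; otherwise `Z(Q) ≤ U`.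
  rcases IsCyclic.le_or_le_of_isPGroup hPl (U.subgroupOf P)
    ((Subgroup.center Q ⊔ commutator Q).subgroupOf P) with h | h
  · exfalso
    have hle : U ≤ Subgroup.center Q ⊔ commutator Q := by
      intro u hu
      obtain ⟨y, hy, n, hn, rfl⟩ := hdec u
      have hyU : y ∈ U := (Subgroup.mul_mem_cancel_right U (hNU hn)).1 hu
      have : (⟨y, hy⟩ : P) ∈ (Subgroup.center Q ⊔ commutator Q).subgroupOf P := h hyU
      exact mul_mem this ((le_sup_right : commutator Q ≤ _) hn)
    have htop : Subgroup.center Q ⊔ commutator Q = ⊤ := by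
      rw [eq_top_iff, ← hU]
      exact sup_le hle le_sup_left
    have hN : commutator Q ≤ Subgroup.center Q :=
      Subgroup.Normal.commutator_le_of_self_sup_commutative_eq_top htop
        ⟨⟨fun x y => Subtype.ext (hab x x.2 y y.2)⟩⟩
    rw [sup_eq_left.2 hN] at htop
    refine hne ?_
    rw [eq_bot_iff, commutator_def, Subgroup.commutator_le]
    intro x _ y _
    rw [Subgroup.mem_bot, commutatorElement_eq_one_iff_mul_comm]
    exact Subgroup.mem_center_iff.1 (htop ▸ Subgroup.mem_top y) x
  · rw [eq_top_iff, ← hU]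
    refine sup_le le_rfl fun z hz => ?_
    obtain ⟨y, hy, n, hn, rfl⟩ := hdec z
    have hyZ : y ∈ Subgroup.center Q ⊔ commutator Q := by
      have := mul_mem ((le_sup_left : Subgroup.center Q ≤ Subgroup.center Q ⊔ commutator Q) hz)
        ((le_sup_right : commutator Q ≤ Subgroup.center Q ⊔ commutator Q) (inv_mem hn))
      rwa [mul_inv_cancel_right] at this
    have : (⟨y, hy⟩ : P) ∈ U.subgroupOf P := h hyZ
    exact mul_mem this (hNU hn)

end FrobeniusGraphs

/-! ### The proposition. -/

theorem mainTheorem12 {G A : Type*} [Group G] [Finite G] [Group A] [Finite A]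
    (p l a q i : ℕ) (hp : p.Prime) (hl : l.Prime) (hlp : l ≠ p) (hq : q = l ^ a)
    -- `G` is the semidirect product of `E` and `C`
    (E C : Subgroup G) (hEnormal : E.Normal) (hEC : Subgroup.IsComplement' E C)
    (hE : FrobeniusGraphs.IsElementaryAbelian p E)
    (hCcyclic : IsCyclic C) (hCcard : Nat.card C = q)
    (hirr : FrobeniusGraphs.ActsIrreduciblyOn C E)
    (hGmin : FrobeniusGraphs.IsMinimalDiameterThree G)
    -- the cyclic direct factor of order `q * l ^ i`
    (hAcyclic : IsCyclic A) (hAcard : Nat.card A = q * l ^ i)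
    -- the group `G_i`, with Sylow `l`-subgroup `P`
    (Gi : Subgroup (G × A)) (hindex : Gi.index = q)
    (P : Sylow l Gi) (hPcyclic : IsCyclic P)
    (hPirr : FrobeniusGraphs.ActsIrreduciblyOn ((P : Subgroup Gi).map Gi.subtype)
      (E.prod (⊥ : Subgroup A))) :
    -- if `G × A` arises from `G_i` by adjoining the central factor, then `G_i` is isoclinic to `G`
    (Gi ⊔ (⊥ : Subgroup G).prod (⊤ : Subgroup A) = ⊤ → FrobeniusGraphs.IsIsoclinic G Gi) ∧
    -- if `G_i` is isoclinic to `G`, then it is minimal with a diameter three subgroup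
    (FrobeniusGraphs.IsIsoclinic G Gi → FrobeniusGraphs.IsMinimalDiameterThree Gi) := by
  have hAcomm : ∀ x y : A, x * y = y * x := fun x y => IsMulCommutative.is_comm.comm x y
  refine ⟨FrobeniusGraphs.isIsoclinic_of_sup_eq_top hAcomm Gi, fun hiso => ?_⟩
  have := Fact.mk hl
  have := Fact.mk hp
  obtain ⟨htr, htrU⟩ := hiso.transfer
  have hD := htr hGmin.1
  refine ⟨hD, fun U hU hUD => ?_⟩
  have hUZ : U ⊔ Subgroup.center Gi = ⊤ := by
    by_contra hcon
    obtain ⟨V, hV, hVD⟩ := htrU U hcon hUD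
    exact hGmin.2 V hV hVD
  have hne := hD.commutator_ne_bot
  have hinj : Function.Injective Gi.subtype := Gi.subtype_injective
  have hGE : commutator G ≤ E := by
    rw [← Subgroup.Normal.quotient_commutative_iff_commutator_le]
    have e := hEC.symm.QuotientMulEquiv
    exact ⟨⟨fun x y => e.injective (by
      rw [map_mul, map_mul]
      exact IsMulCommutative.is_comm.comm (e x) (e y))⟩⟩
  -- The derived subgroup is a nontrivial `P`-invariant subgroup of `E × 1`, because `G / E ≅ C` and
  -- `A` are abelian.
  have hmap : (commutator Gi).map Gi.subtype = E.prod (⊥ : Subgroup A) := by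
    refine (hPirr.2.2 _ ?_ ?_).resolve_left ?_
    · rw [Subgroup.map_le_iff_le_comap, commutator_def, Subgroup.commutator_le]
      intro x _ y _
      refine ⟨hGE (Subgroup.commutator_mem_commutator (Subgroup.mem_top x.1.1)
        (Subgroup.mem_top y.1.1)), ?_⟩
      exact commutatorElement_eq_one_iff_mul_comm.2 (hAcomm x.1.2 y.1.2)
    · rintro _ ⟨s, -, rfl⟩ _ ⟨k, hk, rfl⟩
      exact ⟨s * k * s⁻¹, Subgroup.Normal.conj_mem inferInstance k hk s, by simp⟩
    · rwa [Subgroup.map_eq_bot_iff_of_injective _ hinj]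
  have hab : ∀ x ∈ commutator Gi, ∀ y ∈ commutator Gi, x * y = y * x := by
    have hmem : ∀ x ∈ commutator Gi, (x : G × A).1 ∈ E := fun x hx =>
      (hmap ▸ Subgroup.mem_map_of_mem Gi.subtype hx : (x : G × A) ∈ E.prod (⊥ : Subgroup A)).1
    exact fun x hx y hy => Subtype.ext
      (Prod.ext (hE.1 _ (hmem x hx) _ (hmem y hy)) (hAcomm _ _))
  have hcardN : Nat.card (commutator Gi) = Nat.card E := by
    rw [← Subgroup.card_map_of_injective hinj, hmap,
      Nat.card_congr (Subgroup.prodEquiv E (⊥ : Subgroup A)).toEquiv, Nat.card_prod,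
      Subgroup.card_bot, mul_one]
  have hEp : IsPGroup p E := fun x => ⟨1, Subtype.ext (by
    rw [pow_one]
    exact hE.2 x x.2)⟩
  obtain ⟨n, hn⟩ := IsPGroup.iff_card.1 hEp
  have hcardGi : Nat.card Gi = l ^ (a + i) * p ^ n := by
    have h1 := Gi.card_mul_index
    rw [hindex, Nat.card_prod, ← hEC.card_mul_card, hCcard, hAcard, hn] at h1
    have hq0 : 0 < q := by rw [hq]; exact pow_pos hl.pos a
    refine Nat.eq_of_mul_eq_mul_right hq0 (h1.trans ?_)
    rw [pow_add, ← hq]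
    ring
  have hcop : Nat.Coprime l p := (Nat.coprime_primes hl hp).2 hlp
  have hcardP : Nat.card P = l ^ (a + i) := by
    rw [P.card_eq_multiplicity, hcardGi, Nat.factorization_mul (pow_ne_zero _ hl.ne_zero)
      (pow_ne_zero _ hp.ne_zero)]
    simp [hl.factorization_self, Nat.factorization_eq_zero_of_not_dvd
      (fun h => hlp ((Nat.prime_dvd_prime_iff_eq hl hp).1 h))]
  -- The index `q` gives `|Gi| = l ^ (a + i) * |E|`, so the coprime orders of `P` and the derived
  -- subgroup multiply to `|Gi|`.
  have hcompl : Subgroup.IsComplement' (P : Subgroup Gi) (commutator Gi) := by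
    refine Subgroup.isComplement'_of_coprime ?_ ?_
    · rw [hcardN, hn, hcardGi]
      exact congrArg (· * p ^ n) hcardP
    · rw [hcardN, hn]
      exact hcardP ▸ Nat.Coprime.pow _ _ hcop
  exact hU (FrobeniusGraphs.eq_top_of_sup_center_eq_top hne hab P P.isPGroup' hPcyclic
    hcompl.sup_eq_top U hUZ)
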